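/- Let $n\ge 1$, and let $X=X^{2n}$ be a quasitoric manifold with the action of $G=T^n=(S^1)^n$. That is, $X$ is a smooth manifold of dimension $2n$ with an action of $T^n$ that is locally standard (every point has an invariant open neighbourhood that is diffeomorphic to an open subset of $\mathbb{C}^n$ by a diffeomorphism carrying the action, up to an automorphism of $T^n$, to the coordinatewise action of $T^n$ on $\mathbb{C}^n$), and the orbit space $X/G$ is isomorphic, as a manifold with corners, to a simple polytope of dimension $n$. Let $T\subset G$ be a subtorus of dimension $n-1$ such that the induced action of $T$ on $X$ is in general position: at every point of $X$ fixed by $T$, any $n-1$ of the $n$ weights $\alpha_1,\dots,\alpha_n\in\operatorname{Hom}(T,S^1)\cong\mathbb{Z}^{n-1}$ of the tangent representation (which are defined up to order and signs) are linearly independent. Then the orbit space $X/T$ is homeomorphic to the sphere $S^{n+1}$. -/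

import Mathlib

open scoped Manifold ContDiff

/-- The compact torus `T^n`, a product of `n` copies of the unit circle in `ℂ`. -/
abbrev Torus (n : ℕ) : Type := Fin n → Circle

/-- A subgroup of `T^n` is a subtorus of dimension `k` if it is isomorphic to `T^k` as a topological
group (it is then compact, hence closed). -/
def IsSubtorus {n : ℕ} (k : ℕ) (T : Subgroup (Torus n)) : Prop :=
  Nonempty (T ≃ₜ* Torus k)

/-- A simple polytope of dimension `n` in `ℝ^n`: a bounded set with non-empty interior, given by
finitely many linear inequalities `⟪a i, x⟫ + b i ≥ 0`, such that exactly `n` of the inequalities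
are equalities at each vertex (extreme point). At a vertex the normals `a i` of the `n` active
inequalities then form a basis; so every inequality that is active somewhere on the
polytope defines a facet, and distinct active inequalities define distinct facets. -/
structure SimplePolytope (n : ℕ) where
  /-- the number of inequalities -/
  m : ℕ
  /-- the inner normal vectors -/
  a : Fin m → EuclideanSpace ℝ (Fin n)
  /-- the constant terms -/
  b : Fin m → ℝ
  isBounded : Bornology.IsBounded {x | ∀ i, 0 ≤ inner ℝ (a i) x + b i}
  nonempty_interior : (interior {x | ∀ i, 0 ≤ inner ℝ (a i) x + b i}).Nonempty
  simple : ∀ v ∈ Set.extremePoints ℝ {x | ∀ i, 0 ≤ inner ℝ (a i) x + b i},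
    {i | inner ℝ (a i) v + b i = 0}.ncard = n

/-- The underlying set of points of a simple polytope. -/
def SimplePolytope.carrier {n : ℕ} (P : SimplePolytope n) : Set (EuclideanSpace ℝ (Fin n)) :=
  {x | ∀ i, 0 ≤ inner ℝ (P.a i) x + P.b i}

/-- The number of facets of `P` that contain `x`, which is the codimension of the smallest face
through `x`, i.e. the depth of `x` in the manifold with corners `P`. -/
noncomputable def SimplePolytope.depth {n : ℕ} (P : SimplePolytope n)
    (x : EuclideanSpace ℝ (Fin n)) : ℕ :=
  {i | inner ℝ (P.a i) x + P.b i = 0}.ncard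

section Actions

variable (n : ℕ) (X : Type*) [TopologicalSpace X]
  [ChartedSpace (EuclideanSpace ℝ (Fin (2 * n))) X] [MulAction (Torus n) X]

/-- A standard chart of a `T^n`-action on a smooth manifold `X` of dimension `2n`: a diffeomorphism
from a `T^n`-invariant open subset of `X` onto an open subset of `ℂ^n`, which turns the action
into the coordinatewise action on `ℂ^n`, up to an automorphism of `T^n`. -/
structure StandardChart extends OpenPartialHomeomorph X (Fin n → ℂ) where
  smul_mem_source : ∀ (t : Torus n) (x : X), x ∈ source → t • x ∈ source
  contMDiffOn_toFun : ContMDiffOn (𝓡 (2 * n)) 𝓘(ℝ, Fin n → ℂ) ∞ toFun source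
  contMDiffOn_invFun : ContMDiffOn 𝓘(ℝ, Fin n → ℂ) (𝓡 (2 * n)) ∞ invFun target
  /-- the automorphism of the torus -/
  aut : Torus n ≃ₜ* Torus n
  map_smul : ∀ (t : Torus n) (x : X), x ∈ source → ∀ i : Fin n,
    toFun (t • x) i = (aut t i : ℂ) * toFun x i

/-- The action of `T^n` on `X` is locally standard: `X` is covered by standard charts. (In
particular the action is smooth.) -/
def IsLocallyStandard : Prop :=
  ∀ x : X, ∃ c : StandardChart n X, x ∈ c.source

variable {n X} in
/-- The map which a standard chart induces on orbit spaces takes values in the corner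
`ℂ^n / T^n ≅ [0, ∞)^n`; the depth of the orbit of `x` in the manifold with corners `X / T^n` is the
number of coordinates of its image that vanish. -/
noncomputable def StandardChart.depth (c : StandardChart n X) (x : X) : ℕ :=
  {i : Fin n | c.toFun x i = 0}.ncard

/-- `X` with its `T^n`-action is a quasitoric manifold: the action is locally standard, and the
orbit space `X / T^n` is isomorphic to a simple polytope as a manifold with corners, i.e. by a
homeomorphism that preserves the depth of points (and thus maps faces onto faces). -/
def IsQuasitoric : Prop :=
  IsLocallyStandard n X ∧
    ∃ (P : SimplePolytope n) (h : Quotient (MulAction.orbitRel (Torus n) X) ≃ₜ P.carrier),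
      ∀ (c : StandardChart n X) (x : X), x ∈ c.source →
        P.depth (h (Quotient.mk _ x)) = c.depth x

end Actions

section GeneralPosition

variable {n : ℕ} (H : Type*) [Group H] [TopologicalSpace H]
  {X : Type*} [TopologicalSpace X] [ChartedSpace (EuclideanSpace ℝ (Fin (2 * n))) X]
  [MulAction H X]

variable {H} in
/-- `α 1, …, α n : H → S¹` are the weights of the tangent representation of `H` at the fixed point
`x`: the tangent space at `x`, on which `t : H` acts by the derivative of `y ↦ t • y`, is
isomorphic as a real representation to `V(α 1) ⊕ … ⊕ V(α n)`, where `V(α)` is `ℂ` with the action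
`t z = α(t) z`. -/
def AreTangentWeights (x : X) (α : Fin n → (H →ₜ* Circle)) : Prop :=
  ∃ e : TangentSpace (𝓡 (2 * n)) x ≃ₗ[ℝ] (Fin n → ℂ),
    ∀ (t : H) (v : TangentSpace (𝓡 (2 * n)) x) (i : Fin n),
      e (mfderiv (𝓡 (2 * n)) (𝓡 (2 * n)) (fun y : X => t • y) x v) i = (α i t : ℂ) * e v i

variable (n X) in
/-- The action of `H` (a torus of dimension `n - 1`) on the `2n`-manifold `X` is in general
position: at each fixed point every `n - 1` of the `n` weights of the tangent representation are
linearly independent in the group `Hom(H, S¹)`. The weights exist for every smooth torus action;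
they are unique up to order and signs, on which the condition does not depend. -/
def IsInGeneralPosition : Prop :=
  ∀ x : X, (∀ t : H, t • x = x) →
    ∀ α : Fin n → (H →ₜ* Circle), AreTangentWeights x α →
      ∀ i : Fin n, LinearIndependent ℤ (fun j : {j : Fin n // j ≠ i} => Additive.ofMul (α j))

end GeneralPosition

/-- The character `s ↦ ∏ j, s j ^ m j` of the torus. -/
noncomputable def torusMonomial {k : ℕ} (m : Fin k → ℤ) : Torus k →ₜ* Circle where
  toFun s := ∏ j, s j ^ m j
  map_one' := by simp
  map_mul' s t := by simp [mul_zpow, Finset.prod_mul_distrib]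
  continuous_toFun := by fun_prop

theorem torusMonomial_apply {k : ℕ} (m : Fin k → ℤ) (s : Torus k) :
    torusMonomial m s = ∏ j, s j ^ m j := rfl

theorem torusMonomial_zero {k : ℕ} (s : Torus k) : torusMonomial 0 s = 1 := by
  simp [torusMonomial_apply]

theorem torusMonomial_add {k : ℕ} (m m' : Fin k → ℤ) (s : Torus k) :
    torusMonomial (m + m') s = torusMonomial m s * torusMonomial m' s := by
  simp [torusMonomial_apply, zpow_add, Finset.prod_mul_distrib]

theorem torusMonomial_zsmul {k : ℕ} (a : ℤ) (m : Fin k → ℤ) (s : Torus k) :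
    torusMonomial (a • m) s = torusMonomial m s ^ a := by
  simp [torusMonomial_apply, zpow_mul', Finset.prod_zpow]

theorem torusMonomial_sum {k : ℕ} {ι : Type*} (I : Finset ι) (a : ι → ℤ) (m : ι → Fin k → ℤ)
    (s : Torus k) :
    torusMonomial (∑ i ∈ I, a i • m i) s = ∏ i ∈ I, torusMonomial (m i) s ^ a i := by
  classical
  induction I using Finset.induction_on with
  | empty => simp [torusMonomial_zero]
  | insert i I hi ih =>
    rw [Finset.sum_insert hi, Finset.prod_insert hi, torusMonomial_add, torusMonomial_zsmul, ih]

theorem torusMonomial_single {k : ℕ} (i : Fin k) (s : Torus k) :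
    torusMonomial (Pi.single i 1) s = s i := by
  rw [torusMonomial_apply, Finset.prod_eq_single i]
  · simp
  · intro j _ hj; simp [hj]
  · simp

/-- Continuous additive-to-multiplicative maps from the additive circle to the circle are powers of
the standard character. -/
theorem exists_zpow_of_addCircle (f : AddCircle (1 : ℝ) → Circle) (hf : Continuous f)
    (hmul : ∀ x y, f (x + y) = f x * f y) :
    ∃ k : ℤ, ∀ x, f x = AddCircle.toCircle x ^ k := by
  let F : C(AddCircle (1 : ℝ), ℂ) := ⟨fun x => f x, by fun_prop⟩
  have h0 : f 0 = 1 := by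
    have := hmul 0 0
    simpa using this
  have hne : ∃ k, fourierCoeff F k ≠ 0 := by
    by_contra! h
    have hz : fourierCoeff F = 0 := funext h
    have := has_pointwise_sum_fourier_series_of_summable (f := F) (by rw [hz]; exact summable_zero) 0
    rw [hz] at this
    simp only [Pi.zero_apply, zero_smul] at this
    have h2 := this.unique hasSum_zero
    simp [F, h0] at h2
  obtain ⟨k, hk⟩ := hne
  refine ⟨k, fun y => ?_⟩
  have key : fourierCoeff F k = (f y : ℂ) * fourier (-k) y * fourierCoeff F k := by
    conv_lhs => rw [fourierCoeff, ← MeasureTheory.integral_add_right_eq_self _ y]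
    rw [fourierCoeff, ← MeasureTheory.integral_const_mul]
    congr 1
    ext x
    simp only [F, ContinuousMap.coe_mk, hmul, smul_eq_mul, fourier_apply, smul_add,
      AddCircle.toCircle_add, Circle.coe_mul]
    ring
  have h1 : (f y : ℂ) * fourier (-k) y = 1 := by
    have : ((f y : ℂ) * fourier (-k) y - 1) * fourierCoeff F k = 0 := by linear_combination -key
    rcases mul_eq_zero.1 this with h | h
    · linear_combination h
    · exact absurd h hk
  have h2 : f y * (AddCircle.toCircle y ^ k)⁻¹ = 1 := by
    ext
    rw [Circle.coe_mul, ← AddCircle.toCircle_zsmul, ← AddCircle.toCircle_neg, ← neg_smul]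
    simpa [fourier_apply] using h1
  exact mul_inv_eq_one.1 h2

theorem exists_zpow_of_circle (f : Circle →ₜ* Circle) : ∃ k : ℤ, ∀ z, f z = z ^ k := by
  obtain ⟨k, hk⟩ := exists_zpow_of_addCircle (fun x => f (AddCircle.toCircle x))
    (f.continuous_toFun.comp AddCircle.continuous_toCircle)
    (fun x y => by rw [AddCircle.toCircle_add, map_mul])
  refine ⟨k, fun z => ?_⟩
  obtain ⟨x, rfl⟩ := (AddCircle.homeomorphCircle (one_ne_zero' ℝ)).surjective z
  rw [AddCircle.homeomorphCircle_apply]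
  exact hk x

theorem exists_eq_torusMonomial {k : ℕ} (f : Torus k →ₜ* Circle) :
    ∃ m : Fin k → ℤ, f = torusMonomial m := by
  have (j : Fin k) : ∃ a : ℤ, ∀ z : Circle, f (Pi.mulSingle j z) = z ^ a :=
    exists_zpow_of_circle ⟨f.toMonoidHom.comp (MonoidHom.mulSingle (fun _ => Circle) j),
      f.continuous_toFun.comp
        (continuous_mulSingle (A := fun _ : Fin k => Circle) j)⟩
  choose m hm using this
  refine ⟨m, ?_⟩
  ext s : 1
  conv_lhs => rw [← Finset.univ_prod_mulSingle s]
  rw [map_prod, torusMonomial_apply]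
  exact Finset.prod_congr rfl fun j _ => hm j _

theorem circle_zpow_surjective {k : ℤ} (hk : k ≠ 0) (z : Circle) : ∃ w : Circle, w ^ k = z := by
  refine ⟨Circle.exp (z.val.arg / k), ?_⟩
  rw [← Circle.exp_zsmul, zsmul_eq_mul, mul_div_cancel₀ _ (by exact_mod_cast hk),
    Circle.exp_arg]

theorem torusMonomial_mulSingle {k : ℕ} (m : Fin k → ℤ) (i : Fin k) (z : Circle) :
    torusMonomial m (Pi.mulSingle i z) = z ^ m i := by
  rw [torusMonomial_apply, Finset.prod_eq_single i]
  · simp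
  · intro j _ hj; simp [hj]
  · simp

theorem torusMonomial_surjective {k : ℕ} {m : Fin k → ℤ} (hm : m ≠ 0) :
    Function.Surjective (torusMonomial m) := by
  obtain ⟨i, hi⟩ := Function.ne_iff.1 hm
  intro z
  obtain ⟨w, hw⟩ := circle_zpow_surjective hi z
  exact ⟨Pi.mulSingle i w, by rw [torusMonomial_mulSingle, hw]⟩

theorem exists_hom_circle_ne_one {A : Type*} [AddCommGroup A] {a : A} (ha : a ≠ 0) :
    ∃ f : A → Circle, (∀ x y, f (x + y) = f x * f y) ∧ f a ≠ 1 := by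
  obtain ⟨c, hc⟩ := CharacterModule.exists_character_apply_ne_zero_of_ne_zero ha
  let ι : AddCircle (1 : ℚ) →+ AddCircle (1 : ℝ) :=
    QuotientAddGroup.map _ _ (Rat.castHom ℝ).toAddMonoidHom (by
      intro x hx
      obtain ⟨k, rfl⟩ := AddSubgroup.mem_zmultiples_iff.1 hx
      exact AddSubgroup.mem_zmultiples_iff.2 ⟨k, by simp⟩)
  have hι : Function.Injective ι := by
    rw [injective_iff_map_eq_zero]
    intro x
    induction x using QuotientAddGroup.induction_on with
    | H x =>
      intro hx
      have hx' : ((x : ℝ) : AddCircle (1 : ℝ)) = 0 := hx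
      obtain ⟨k, hk⟩ := (AddCircle.coe_eq_zero_iff _).1 hx'
      refine (AddCircle.coe_eq_zero_iff _).2 ⟨k, ?_⟩
      simp only [zsmul_eq_mul, mul_one] at hk ⊢
      exact_mod_cast hk
  refine ⟨fun x => AddCircle.toCircle (ι (c x)), fun x y => by
    simp only [map_add, AddCircle.toCircle_add], fun h => hc ?_⟩
  apply hι
  apply AddCircle.injective_toCircle one_ne_zero
  simpa using h

/-- A subtorus of codimension one is the kernel of a non-trivial monomial character. -/
theorem IsSubtorus.exists_torusMonomial {n : ℕ} (hn : 1 ≤ n) {T : Subgroup (Torus n)}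
    (hT : IsSubtorus (n - 1) T) :
    ∃ m : Fin n → ℤ, m ≠ 0 ∧ ∀ g : Torus n, torusMonomial m g = 1 ↔ g ∈ T := by
  obtain ⟨φ⟩ := hT
  have hcoord (i : Fin n) : ∃ a : Fin (n - 1) → ℤ,
      ∀ s, (φ.symm s : Torus n) i = torusMonomial a s := by
    obtain ⟨a, ha⟩ := exists_eq_torusMonomial
      (⟨((Pi.evalMonoidHom (fun _ => Circle) i).comp T.subtype).comp φ.symm.toMulEquiv.toMonoidHom,
        ((continuous_apply i).comp continuous_subtype_val).comp φ.symm.continuous_toFun⟩ :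
        Torus (n - 1) →ₜ* Circle)
    exact ⟨a, fun s => DFunLike.congr_fun ha s⟩
  choose A hA using hcoord
  let B : (Fin n → ℤ) →ₗ[ℤ] (Fin (n - 1) → ℤ) := Fintype.linearCombination ℤ A
  have hB (m : Fin n → ℤ) (s) : torusMonomial m (φ.symm s : Torus n) = torusMonomial (B m) s := by
    simp only [B, Fintype.linearCombination_apply, torusMonomial_sum]
    rw [torusMonomial_apply]
    exact Finset.prod_congr rfl fun i _ => by rw [hA]
  have hsurj : Function.Surjective B := by
    rw [← LinearMap.range_eq_top]
    by_contra hne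
    obtain ⟨y, hy⟩ : ∃ y, y ∉ LinearMap.range B := by
      by_contra! h
      exact hne (eq_top_iff.2 fun y _ => h y)
    obtain ⟨f, hf, hf1⟩ := exists_hom_circle_ne_one
      (a := (LinearMap.range B).mkQ y) (by simpa using hy)
    let F : Multiplicative (Fin (n - 1) → ℤ) →* Circle := MonoidHom.mk'
      (fun m => f ((LinearMap.range B).mkQ m.toAdd)) (fun x y => by rw [← hf, ← map_add]; rfl)
    let s : Torus (n - 1) := fun j => F (Multiplicative.ofAdd (Pi.single j 1))
    have hs (m : Fin (n - 1) → ℤ) : torusMonomial m s = F (Multiplicative.ofAdd m) := by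
      have : Multiplicative.ofAdd m =
          ∏ j, (Multiplicative.ofAdd (Pi.single j 1 : Fin (n - 1) → ℤ)) ^ m j := by
        apply Multiplicative.toAdd.injective
        rw [toAdd_prod]
        simp only [toAdd_ofAdd, toAdd_zpow]
        exact pi_eq_sum_univ' m
      rw [this, map_prod, torusMonomial_apply]
      simp [s]
    have h1 : φ.symm s = 1 := by
      ext i : 2
      have : A i = B (Pi.single i 1) := by simp [B, Fintype.linearCombination_apply_single]
      rw [hA, hs, this]
      have h0 : f 0 = 1 := by simpa using hf 0 0
      change f ((LinearMap.range B).mkQ (B (Pi.single i 1))) = 1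
      rw [Submodule.mkQ_apply, (Submodule.Quotient.mk_eq_zero _).2 (LinearMap.mem_range_self B _), h0]
    have h2 : s = 1 := by
      have := congrArg φ h1
      simpa using this
    apply hf1
    have := hs y
    rw [h2, map_one] at this
    exact this.symm
  obtain ⟨σ, hσ⟩ := Module.projective_lifting_property B LinearMap.id hsurj
  have hσ' (y) : B (σ y) = y := LinearMap.congr_fun hσ y
  have hrank : Module.finrank ℤ (LinearMap.ker B) = 1 := by
    have := Submodule.finrank_quotient_add_finrank (LinearMap.ker B)
    rw [(B.quotKerEquivOfSurjective hsurj).finrank_eq] at this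
    simp at this
    omega
  let b := Module.basisUnique Unit hrank
  have hker (m : Fin n → ℤ) (hm : B m = 0) : ∃ a : ℤ, m = a • (b () : Fin n → ℤ) := by
    refine ⟨b.repr ⟨m, hm⟩ (), ?_⟩
    have := b.sum_repr ⟨m, hm⟩
    simp only [Finset.univ_unique, Finset.sum_singleton] at this
    exact (congrArg Subtype.val this).symm
  refine ⟨(b () : Fin n → ℤ), fun h => b.ne_zero () (Subtype.ext h), fun g => ⟨fun hg => ?_, fun hg => ?_⟩⟩
  · let s : Torus (n - 1) := fun j => torusMonomial (σ (Pi.single j 1)) g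
    have : (φ.symm s : Torus n) = g := by
      ext i : 1
      have h1 : torusMonomial (A i) s = torusMonomial (σ (A i)) g := by
        conv_rhs => rw [pi_eq_sum_univ' (A i), map_sum]
        simp only [map_zsmul, torusMonomial_sum]
        rw [torusMonomial_apply]
      obtain ⟨a, ha⟩ := hker (Pi.single i 1 - σ (A i)) (by
        rw [map_sub, hσ']; simp [B, Fintype.linearCombination_apply_single])
      have h2 : (Pi.single i 1 : Fin n → ℤ) = a • (b () : Fin n → ℤ) + σ (A i) := by
        rw [← ha]; abel
      rw [hA, h1, ← torusMonomial_single i g, h2, torusMonomial_add, torusMonomial_zsmul, hg]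
      simp
    rw [← this]
    exact (φ.symm s).2
  · have := hB (b ()) (φ ⟨g, hg⟩)
    rw [ContinuousMulEquiv.symm_apply_apply] at this
    rw [this, show B (b ()) = 0 from (b ()).2, torusMonomial_zero]

namespace SimplePolytope

variable {n : ℕ} (P : SimplePolytope n)

theorem isClosed_carrier : IsClosed P.carrier := by
  have : P.carrier = ⋂ i, {x | 0 ≤ inner ℝ (P.a i) x + P.b i} := by
    ext x; simp [carrier]
  rw [this]
  exact isClosed_iInter fun i => isClosed_le continuous_const (by fun_prop)

theorem isCompact_carrier : IsCompact P.carrier :=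
  Metric.isCompact_of_isClosed_isBounded P.isClosed_carrier P.isBounded

theorem convex_carrier : Convex ℝ P.carrier := by
  intro x hx y hy s t hs ht hst i
  have h1 := mul_nonneg hs (hx i)
  have h2 := mul_nonneg ht (hy i)
  rw [inner_add_right, inner_smul_right, inner_smul_right]
  have : P.b i = s * P.b i + t * P.b i := by rw [← add_mul, hst, one_mul]
  rw [this]
  nlinarith

/-- Every point of a polytope lies on a face that has a vertex. -/
theorem exists_extremePoint {p : EuclideanSpace ℝ (Fin n)} (hp : p ∈ P.carrier) :
    ∃ v ∈ Set.extremePoints ℝ P.carrier,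
      ∀ i, inner ℝ (P.a i) p + P.b i = 0 → inner ℝ (P.a i) v + P.b i = 0 := by
  set F := P.carrier ∩ {y | ∀ i, inner ℝ (P.a i) p + P.b i = 0 → inner ℝ (P.a i) y + P.b i = 0}
    with hF
  have hclosed : IsClosed
      {y | ∀ i, inner ℝ (P.a i) p + P.b i = 0 → inner ℝ (P.a i) y + P.b i = 0} := by
    simp only [Set.ofPred_forall]
    exact isClosed_iInter fun i => isClosed_iInter fun _ => isClosed_eq (by fun_prop) (by fun_prop)
  obtain ⟨v, hv⟩ := (P.isCompact_carrier.inter_right hclosed).extremePoints_nonempty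
    ⟨p, hp, fun i hi => hi⟩
  have hext : IsExtreme ℝ P.carrier F := by
    refine ⟨Set.inter_subset_left, ?_⟩
    rintro x hx y hy z ⟨-, hz⟩ ⟨s, t, hs, ht, hst, rfl⟩
    refine ⟨hx, fun i hi => ?_⟩
    have h := hz i hi
    rw [inner_add_right, inner_smul_right, inner_smul_right] at h
    have h1 : 0 ≤ inner ℝ (P.a i) x + P.b i := hx i
    have h2 : 0 ≤ inner ℝ (P.a i) y + P.b i := hy i
    have h3 : s * (inner ℝ (P.a i) x + P.b i) + t * (inner ℝ (P.a i) y + P.b i) = 0 := by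
      have : P.b i = s * P.b i + t * P.b i := by rw [← add_mul, hst, one_mul]
      linarith
    have h4 := mul_nonneg hs.le h1
    have h5 := mul_nonneg ht.le h2
    have h6 : s * (inner ℝ (P.a i) x + P.b i) = 0 := by linarith
    exact (mul_eq_zero.1 h6).resolve_left hs.ne'
  exact ⟨v, hext.extremePoints_subset_extremePoints hv, hv.1.2⟩

/-- The normals of the inequalities that are active at a vertex span the space. -/
theorem span_active_eq_top {v : EuclideanSpace ℝ (Fin n)}
    (hv : v ∈ Set.extremePoints ℝ P.carrier) :
    Submodule.span ℝ (P.a '' {i | inner ℝ (P.a i) v + P.b i = 0}) = ⊤ := by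
  rw [← Submodule.orthogonal_eq_bot_iff, Submodule.eq_bot_iff]
  intro w hw
  have hact (i) (hi : inner ℝ (P.a i) v + P.b i = 0) : inner ℝ (P.a i) w = 0 :=
    (Submodule.mem_orthogonal _ _).1 hw _ (Submodule.subset_span ⟨i, hi, rfl⟩)
  have hev : ∀ᶠ ε : ℝ in nhds 0, v + ε • w ∈ P.carrier := by
    refine Filter.eventually_all.2 fun i => ?_
    by_cases hi : inner ℝ (P.a i) v + P.b i = 0
    · refine Filter.Eventually.of_forall fun ε => ?_
      rw [inner_add_right, inner_smul_right, hact i hi, mul_zero, add_zero, hi]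
    · have hpos : 0 < inner ℝ (P.a i) (v + (0 : ℝ) • w) + P.b i := by
        rw [zero_smul, add_zero]
        exact lt_of_le_of_ne (hv.1 i) (Ne.symm hi)
      have hc : Continuous fun ε : ℝ => inner ℝ (P.a i) (v + ε • w) + P.b i := by fun_prop
      exact (hc.continuousAt.eventually (lt_mem_nhds hpos)).mono fun _ h => h.le
  obtain ⟨ε, hε, hball⟩ := Metric.eventually_nhds_iff.1 hev
  have h1 := hball (y := ε / 2) (by simp [abs_of_pos hε, hε])
  have h2 := hball (y := -(ε / 2)) (by simp [abs_of_pos hε, hε])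
  have h3 := hv.2 h1 h2 ⟨1 / 2, 1 / 2, by norm_num, by norm_num, by norm_num, by module⟩
  have h4 : (ε / 2) • w = 0 := by simpa using h3
  exact (smul_eq_zero.1 h4).resolve_left (by positivity)

theorem normal_ne_zero {v : EuclideanSpace ℝ (Fin n)}
    (hv : v ∈ Set.extremePoints ℝ P.carrier) {i : Fin P.m}
    (hi : inner ℝ (P.a i) v + P.b i = 0) : P.a i ≠ 0 := by
  intro h0
  classical
  set I := {i | inner ℝ (P.a i) v + P.b i = 0} with hI
  have hfin : (P.a '' I).Finite := (Set.toFinite I).image _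
  have hspan : Submodule.span ℝ (P.a '' (I \ {i})) = ⊤ := by
    rw [eq_top_iff, ← P.span_active_eq_top hv, Submodule.span_le]
    rintro _ ⟨j, hj, rfl⟩
    by_cases hji : j = i
    · subst hji; rw [h0]; exact zero_mem _
    · exact Submodule.subset_span ⟨j, ⟨hj, hji⟩, rfl⟩
  have hcard : n ≤ (I \ {i}).ncard := by
    have h1 := finrank_span_le_card (R := ℝ) (P.a '' (I \ {i}))
    rw [hspan, finrank_top, finrank_euclideanSpace_fin] at h1
    rw [← Set.ncard_eq_toFinset_card'] at h1
    exact h1.trans (Set.ncard_image_le (Set.toFinite _))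
  have := Set.ncard_sdiff_singleton_lt_of_mem (s := I) hi (Set.toFinite _)
  have hs : I.ncard = n := P.simple v hv
  omega

theorem depth_eq_zero_iff {p : EuclideanSpace ℝ (Fin n)} :
    P.depth p = 0 ↔ ∀ i, inner ℝ (P.a i) p + P.b i ≠ 0 := by
  rw [depth, Set.ncard_eq_zero (Set.toFinite _), Set.eq_empty_iff_forall_notMem]
  rfl

theorem mem_interior_iff {p : EuclideanSpace ℝ (Fin n)} (hp : p ∈ P.carrier) :
    p ∈ interior P.carrier ↔ P.depth p = 0 := by
  rw [depth_eq_zero_iff]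
  constructor
  · intro hint i hi
    obtain ⟨v, hv, hact⟩ := P.exists_extremePoint hp
    apply P.normal_ne_zero hv (hact i hi)
    have hc : Continuous fun ε : ℝ => p - ε • P.a i := by fun_prop
    have hev : ∀ᶠ ε : ℝ in nhds 0, p - ε • P.a i ∈ P.carrier :=
      hc.continuousAt.eventually_mem (by simpa using mem_interior_iff_mem_nhds.1 hint)
    obtain ⟨ε, hε, hball⟩ := Metric.eventually_nhds_iff.1 hev
    have h1 := hball (y := ε / 2) (by simp [abs_of_pos hε, hε]) i
    rw [inner_sub_right, inner_smul_right, real_inner_self_eq_norm_sq] at h1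
    have h2 : ε / 2 * ‖P.a i‖ ^ 2 ≤ 0 := by linarith
    have h3 : ‖P.a i‖ ^ 2 ≤ 0 := nonpos_of_mul_nonpos_right h2 (by positivity)
    have h4 : ‖P.a i‖ ^ 2 = 0 := le_antisymm h3 (by positivity)
    simpa using h4
  · intro h
    rw [mem_interior_iff_mem_nhds]
    refine Filter.eventually_all.2 fun i => ?_
    have hc : Continuous fun y => inner ℝ (P.a i) y + P.b i := by fun_prop
    exact (hc.continuousAt.eventually (lt_mem_nhds
      (lt_of_le_of_ne (hp i) (Ne.symm (h i))))).mono fun _ h => h.le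

/-- Every point of a simple polytope can be joined to a vertex by a segment along which the depth
is constant, except at the vertex. -/
theorem exists_segment {p : EuclideanSpace ℝ (Fin n)} (hp : p ∈ P.carrier) :
    ∃ γ : ℝ → EuclideanSpace ℝ (Fin n), Continuous γ ∧ γ 0 = p ∧ P.depth (γ 1) = n ∧
      (∀ t ∈ Set.Icc (0 : ℝ) 1, γ t ∈ P.carrier) ∧
      ∀ t ∈ Set.Ico (0 : ℝ) 1, P.depth (γ t) = P.depth p := by
  obtain ⟨v, hv, hact⟩ := P.exists_extremePoint hp
  refine ⟨fun t => (1 - t) • p + t • v, by fun_prop, by simp, ?_, ?_, ?_⟩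
  · simp only [sub_self, zero_smul, one_smul, zero_add]
    exact P.simple v hv
  · intro t ht
    exact P.convex_carrier hp hv.1 (by linarith [ht.2]) ht.1 (by ring)
  · intro t ht
    unfold depth
    congr 1
    ext i
    have hr : inner ℝ (P.a i) ((1 - t) • p + t • v) + P.b i =
        (1 - t) * (inner ℝ (P.a i) p + P.b i) + t * (inner ℝ (P.a i) v + P.b i) := by
      rw [inner_add_right, inner_smul_right, inner_smul_right]; ring
    simp only [Set.mem_ofPred_eq, hr]
    constructor
    · intro h
      have h1 : 0 ≤ inner ℝ (P.a i) p + P.b i := hp i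
      have h2 : 0 ≤ inner ℝ (P.a i) v + P.b i := hv.1 i
      have h3 := mul_nonneg (sub_nonneg.2 ht.2.le) h1
      have h4 := mul_nonneg ht.1 h2
      have h5 : (1 - t) * (inner ℝ (P.a i) p + P.b i) = 0 := by linarith
      exact (mul_eq_zero.1 h5).resolve_left (by linarith [ht.2])
    · intro h
      rw [h, hact i h]; ring

end SimplePolytope

/-- The map `ψ` to the circle is equivariant over the set `A` if it changes by the prescribed
factors along the fibres of `q` over `A`. -/
structure IsEquivariantOver {Y B : Type*} [TopologicalSpace Y] (q : Y → B)
    (R : Y → Y → Circle → Prop) (A : Set B) (ψ : Y → Circle) : Prop where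
  continuousOn : ContinuousOn ψ (q ⁻¹' A)
  map_eq : ∀ x y z, q x ∈ A → R x y z → ψ y = z * ψ x

namespace IsEquivariantOver

variable {Y B : Type*} [TopologicalSpace Y] {q : Y → B}
  {R : Y → Y → Circle → Prop} {A A' : Set B} {ψ ψ' : Y → Circle}

theorem mono (h : IsEquivariantOver q R A ψ) (hA : A' ⊆ A) : IsEquivariantOver q R A' ψ :=
  ⟨h.continuousOn.mono (Set.preimage_mono hA), fun x y z hx hR => h.map_eq x y z (hA hx) hR⟩

variable [TopologicalSpace B]

/-- An equivariant map over `A` extends to `A'`, if `A` is a retract of `A'` and there is some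
equivariant map over `A'`. -/
theorem extend (hq : IsOpenQuotientMap q) (hR : ∀ x y z, R x y z → q x = q y)
    (hR' : ∀ x y, q x = q y → ∃ z, R x y z)
    (h : IsEquivariantOver q R A ψ) (h' : IsEquivariantOver q R A' ψ') (hAA : A ⊆ A')
    {r : B → B} (hr : ContinuousOn r A') (hrA : Set.MapsTo r A' A) (hrid : ∀ b ∈ A, r b = b) :
    ∃ φ, IsEquivariantOver q R A' φ ∧ ∀ x, q x ∈ A → φ x = ψ x := by
  choose σ hσ using hq.surjective
  let ρ : B → Circle := fun b => ψ (σ b) / ψ' (σ b)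
  have hρ (x) (hx : q x ∈ A) : ρ (q x) = ψ x / ψ' x := by
    obtain ⟨z, hz⟩ := hR' _ _ (hσ (q x)).symm
    have h1 := h.map_eq _ _ _ hx hz
    have h2 := h'.map_eq _ _ _ (hAA hx) hz
    simp only [ρ, h1, h2, mul_div_mul_left_eq_div]
  have hρc : ContinuousOn ρ A := by
    have hqm : Topology.IsQuotientMap (A.restrictPreimage q) :=
      (hq.isOpenMap.restrictPreimage A).isQuotientMap
        (hq.continuous.restrictPreimage) (Set.restrictPreimage_surjective A hq.surjective)
    rw [continuousOn_iff_continuous_domRestrict, hqm.continuous_iff]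
    have : A.domRestrict ρ ∘ A.restrictPreimage q = (q ⁻¹' A).domRestrict (fun x => ψ x / ψ' x) := by
      ext1 x
      exact hρ x.1 x.2
    rw [this, ← continuousOn_iff_continuous_domRestrict]
    exact h.continuousOn.div' (h'.continuousOn.mono (Set.preimage_mono hAA))
  refine ⟨fun x => ρ (r (q x)) * ψ' x, ⟨?_, ?_⟩, ?_⟩
  · refine ContinuousOn.mul ?_ h'.continuousOn
    exact hρc.comp (hr.comp hq.continuous.continuousOn (Set.mapsTo_preimage q A'))
      (fun x hx => hrA hx)
  · intro x y z hx hxy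
    rw [h'.map_eq x y z hx hxy, ← hR x y z hxy]
    exact mul_left_comm _ _ _
  · intro x hx
    change ρ (r (q x)) * ψ' x = ψ x
    rw [hrid _ hx, hρ x hx, div_mul_cancel]

/-- Equivariant maps over two closed sets can be glued, if one of the sets retracts to the
intersection. -/
theorem glue (hq : IsOpenQuotientMap q) (hR : ∀ x y z, R x y z → q x = q y)
    (hR' : ∀ x y, q x = q y → ∃ z, R x y z) (hA : IsClosed A) (hA' : IsClosed A')
    (h : IsEquivariantOver q R A ψ) (h' : IsEquivariantOver q R A' ψ')
    {r : B → B} (hr : ContinuousOn r A') (hrA : Set.MapsTo r A' (A ∩ A'))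
    (hrid : ∀ b ∈ A ∩ A', r b = b) :
    ∃ φ, IsEquivariantOver q R (A ∪ A') φ := by
  classical
  obtain ⟨φ, hφ, hφψ⟩ := (h.mono Set.inter_subset_left).extend hq hR hR' h'
    Set.inter_subset_right hr hrA hrid
  let F : Y → Circle := fun x => if q x ∈ A then ψ x else φ x
  have hF1 : Set.EqOn F ψ (q ⁻¹' A) := fun x hx => if_pos hx
  have hF2 : Set.EqOn F φ (q ⁻¹' A') := fun x hx => by
    by_cases hxA : q x ∈ A
    · exact (if_pos hxA).trans (hφψ x ⟨hxA, hx⟩).symm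
    · exact if_neg hxA
  refine ⟨F, ⟨?_, ?_⟩⟩
  · rw [Set.preimage_union]
    exact (h.continuousOn.congr hF1).union_of_isClosed (hφ.continuousOn.congr hF2)
      (hA.preimage hq.continuous) (hA'.preimage hq.continuous)
  · rintro x y z (hx | hx) hxy
    · rw [hF1 hx, hF1 (show q y ∈ A from hR x y z hxy ▸ hx)]
      exact h.map_eq x y z hx hxy
    · rw [hF2 hx, hF2 (show q y ∈ A' from hR x y z hxy ▸ hx)]
      exact hφ.map_eq x y z hx hxy

end IsEquivariantOver

section Box

variable {ι : Type*} [Fintype ι] [DecidableEq ι]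

/-- A property of boxes holds for all boxes, if it holds for small boxes and is inherited by a box
from the two halves into which it is cut by a hyperplane. -/
theorem box_induction {p : (ι → ℝ) → (ι → ℝ) → Prop}
    (hsplit : ∀ (a b : ι → ℝ) (i : ι) (c : ℝ), a i ≤ c → c ≤ b i →
      p a (Function.update b i c) → p (Function.update a i c) b → p a b)
    {a₀ b₀ : ι → ℝ} {δ : ℝ} (hδ : 0 < δ)
    (hsmall : ∀ a b : ι → ℝ, a ≤ b → a₀ ≤ a → b ≤ b₀ → (∀ i, b i - a i ≤ δ) → p a b)
    (hab : a₀ ≤ b₀) : p a₀ b₀ := by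
  have main : ∀ m : ℕ, ∀ a b : ι → ℝ, a ≤ b → a₀ ≤ a → b ≤ b₀ → (∀ i, b i - a i ≤ 2 ^ m * δ) →
      p a b := by
    intro m
    induction m with
    | zero => simpa using hsmall
    | succ m ih =>
      have aux : ∀ s : Finset ι, ∀ a b : ι → ℝ, a ≤ b → a₀ ≤ a → b ≤ b₀ →
          (∀ i ∈ s, b i - a i ≤ 2 ^ (m + 1) * δ) → (∀ i ∉ s, b i - a i ≤ 2 ^ m * δ) → p a b := by
        intro s
        induction s using Finset.induction_on with
        | empty => exact fun a b h1 h2 h3 _ h5 => ih a b h1 h2 h3 fun i => h5 i (by simp)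
        | insert i s hi ihs =>
          intro a b h1 h2 h3 h4 h5
          have hi1 := h1 i
          have hi4 := h4 i (Finset.mem_insert_self _ _)
          rw [pow_succ] at hi4
          have hc1 : a i ≤ (a i + b i) / 2 := by linarith
          have hc2 : (a i + b i) / 2 ≤ b i := by linarith
          refine hsplit a b i ((a i + b i) / 2) hc1 hc2 (ihs _ _ ?_ h2 ?_ ?_ ?_)
            (ihs _ _ ?_ ?_ h3 ?_ ?_)
          · exact le_update_iff.2 ⟨hc1, fun j _ => h1 j⟩
          · exact update_le_iff.2 ⟨hc2.trans (h3 i), fun j _ => h3 j⟩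
          · intro j hj
            have : j ≠ i := fun h => hi (h ▸ hj)
            simpa [this] using h4 j (Finset.mem_insert_of_mem hj)
          · intro j hj
            by_cases hji : j = i
            · subst hji; simp; linarith
            · simpa [hji] using h5 j (by simp [hji, hj])
          · exact update_le_iff.2 ⟨hc2, fun j _ => h1 j⟩
          · exact le_update_iff.2 ⟨(h2 i).trans hc1, fun j _ => h2 j⟩
          · intro j hj
            have : j ≠ i := fun h => hi (h ▸ hj)
            simpa [this] using h4 j (Finset.mem_insert_of_mem hj)
          · intro j hj
            by_cases hji : j = i
            · subst hji; simp; linarith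
            · simpa [hji] using h5 j (by simp [hji, hj])
      exact fun a b h1 h2 h3 h4 => aux Finset.univ a b h1 h2 h3 (fun i _ => h4 i) (by simp)
  have hbd : ∀ i, ∃ m : ℕ, b₀ i - a₀ i ≤ 2 ^ m * δ := by
    intro i
    obtain ⟨m, hm⟩ := pow_unbounded_of_one_lt ((b₀ i - a₀ i) / δ) (one_lt_two)
    exact ⟨m, by rw [div_lt_iff₀ hδ] at hm; exact hm.le⟩
  choose M hM using hbd
  refine main (Finset.univ.sup M) a₀ b₀ hab le_rfl le_rfl fun i => (hM i).trans ?_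
  gcongr
  · norm_num
  · exact Finset.le_sup (Finset.mem_univ i)

end Box

section Global

variable {k : ℕ} {Y : Type*} [TopologicalSpace Y] {q : Y → (Fin k → ℝ)}
  {R : Y → Y → Circle → Prop}

theorem IsEquivariantOver.exists_box (hq : IsOpenQuotientMap q)
    (hR : ∀ x y z, R x y z → q x = q y) (hR' : ∀ x y, q x = q y → ∃ z, R x y z)
    (hloc : ∀ b, ∃ V ∈ nhds b, ∃ ψ, IsEquivariantOver q R V ψ)
    {a₀ b₀ : Fin k → ℝ} (hab : a₀ ≤ b₀) : ∃ ψ, IsEquivariantOver q R (Set.Icc a₀ b₀) ψ := by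
  choose V hV hψ using hloc
  obtain ⟨δ, hδ, hball⟩ := lebesgue_number_lemma_of_metric (isCompact_Icc (a := a₀) (b := b₀))
    (c := fun b => interior (V b)) (fun b => isOpen_interior)
    (fun b _ => Set.mem_iUnion.2 ⟨b, mem_interior_iff_mem_nhds.2 (hV b)⟩)
  refine box_induction (p := fun a b => ∃ ψ, IsEquivariantOver q R (Set.Icc a b) ψ) ?_
    (half_pos hδ) ?_ hab
  · rintro a b i c hac hcb ⟨ψ, h⟩ ⟨ψ', h'⟩
    have hunion : Set.Icc a b =
        Set.Icc a (Function.update b i c) ∪ Set.Icc (Function.update a i c) b := by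
      ext x
      simp only [Set.mem_Icc, Set.mem_union, le_update_iff, update_le_iff]
      constructor
      · rintro ⟨h1, h2⟩
        rcases le_total (x i) c with h | h
        · exact Or.inl ⟨h1, h, fun j _ => h2 j⟩
        · exact Or.inr ⟨⟨h, fun j _ => h1 j⟩, h2⟩
      · rintro (⟨h1, h2, h3⟩ | ⟨⟨h1, h2⟩, h3⟩)
        · refine ⟨h1, fun j => ?_⟩
          by_cases hj : j = i
          · subst hj; exact h2.trans hcb
          · exact h3 j hj
        · refine ⟨fun j => ?_, h3⟩
          by_cases hj : j = i
          · subst hj; exact hac.trans h1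
          · exact h2 j hj
    rw [hunion]
    refine h.glue hq hR hR' isClosed_Icc isClosed_Icc h'
      (r := fun x => Function.update x i c) (by fun_prop) ?_ ?_
    · rintro x ⟨h1, h2⟩
      rw [update_le_iff] at h1
      refine ⟨⟨le_update_iff.2 ⟨hac, h1.2⟩, ?_⟩, ⟨?_, update_le_iff.2 ⟨hcb, fun j _ => h2 j⟩⟩⟩
      · exact update_le_update_iff.2 ⟨le_rfl, fun j _ => h2 j⟩
      · exact update_le_update_iff.2 ⟨le_rfl, h1.2⟩
    · rintro x ⟨⟨-, h2⟩, ⟨h3, -⟩⟩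
      have : x i = c := le_antisymm (le_update_iff.1 h2).1 (update_le_iff.1 h3).1
      rw [← this, Function.update_eq_self]
  · intro a b h1 h2 h3 h4
    obtain ⟨b', hb'⟩ := hball a ⟨h2, h1.trans h3⟩
    obtain ⟨ψ, hψ⟩ := hψ b'
    refine ⟨ψ, hψ.mono fun x hx => interior_subset (hb' ?_)⟩
    rw [Metric.mem_ball]
    refine lt_of_le_of_lt ((dist_pi_le_iff (half_pos hδ).le).2 fun i => ?_) (half_lt_self hδ)
    rw [Real.dist_eq, abs_of_nonneg (sub_nonneg.2 (hx.1 i))]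
    linarith [hx.2 i, h4 i]

/-- Over `ℝ^k` local equivariant maps to the circle can be glued to a global one. -/
theorem IsEquivariantOver.exists_global (hq : IsOpenQuotientMap q)
    (hR : ∀ x y z, R x y z → q x = q y) (hR' : ∀ x y, q x = q y → ∃ z, R x y z)
    (hloc : ∀ b, ∃ V ∈ nhds b, ∃ ψ, IsEquivariantOver q R V ψ) :
    ∃ ψ, IsEquivariantOver q R Set.univ ψ := by
  let C : ℕ → Set (Fin k → ℝ) := fun m => Set.Icc (fun _ => -(m : ℝ)) (fun _ => (m : ℝ))
  have hCle (m : ℕ) : (fun _ => -(m : ℝ) : Fin k → ℝ) ≤ (fun _ => (m : ℝ)) := fun _ => by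
    have : (0 : ℝ) ≤ m := m.cast_nonneg
    simp only; linarith
  have hmono : Monotone C := fun m m' h => Set.Icc_subset_Icc
    (fun _ => by simpa using h) (fun _ => by simpa using h)
  have hstep (m : ℕ) (ψ : Y → Circle) (hψ : IsEquivariantOver q R (C m) ψ) :
      ∃ φ, IsEquivariantOver q R (C (m + 1)) φ ∧ ∀ x, q x ∈ C m → φ x = ψ x := by
    obtain ⟨ψ', hψ'⟩ := IsEquivariantOver.exists_box hq hR hR' hloc (hCle (m + 1))
    refine hψ.extend hq hR hR' hψ' (hmono m.le_succ)
      (r := fun x i => max (-(m : ℝ)) (min (m : ℝ) (x i))) ?_ ?_ ?_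
    · fun_prop
    · intro x _
      exact ⟨fun i => le_max_left _ _, fun i => max_le (hCle m i) (min_le_left _ _)⟩
    · intro x hx
      ext i
      rw [min_eq_right (hx.2 i), max_eq_right (hx.1 i)]
  obtain ⟨ψ₀, hψ₀⟩ := IsEquivariantOver.exists_box hq hR hR' hloc (hCle 0)
  choose! S hS hS' using hstep
  let Ψ : ℕ → Y → Circle := fun m => Nat.rec ψ₀ S m
  have hΨ (m : ℕ) : IsEquivariantOver q R (C m) (Ψ m) := by
    induction m with
    | zero => exact hψ₀
    | succ m ih => exact hS m _ ih
  have hΨ' (m m' : ℕ) (h : m ≤ m') (x : Y) (hx : q x ∈ C m) : Ψ m' x = Ψ m x := by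
    induction m', h using Nat.le_induction with
    | base => rfl
    | succ m' h ih => exact (hS' m' _ (hΨ m') x (hmono h hx)).trans ih
  have hex (b : Fin k → ℝ) : ∃ m : ℕ, C m ∈ nhds b := by
    obtain ⟨m, hm⟩ := exists_nat_gt ‖b‖
    refine ⟨m, Filter.mem_of_superset (Metric.isOpen_ball.mem_nhds
      (show b ∈ Metric.ball (0 : Fin k → ℝ) m by simpa using hm)) fun x hx => ?_⟩
    have hx' (i) : |x i| ≤ m := (norm_le_pi_norm x i).trans (by simpa using (mem_ball_zero_iff.1 hx).le)
    exact ⟨fun i => (abs_le.1 (hx' i)).1, fun i => (abs_le.1 (hx' i)).2⟩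
  choose N hN using hex
  have hΨN (m : ℕ) (x : Y) (hx : q x ∈ C m) : Ψ (N (q x)) x = Ψ m x := by
    rw [← hΨ' _ _ (le_max_left (N (q x)) m) x (mem_of_mem_nhds (hN _)),
      hΨ' _ _ (le_max_right (N (q x)) m) x hx]
  refine ⟨fun x => Ψ (N (q x)) x, ⟨?_, ?_⟩⟩
  · refine continuousOn_of_forall_continuousAt fun x _ => ?_
    have hnear : q ⁻¹' C (N (q x)) ∈ nhds x := hq.continuous.continuousAt (hN (q x))
    refine (((hΨ (N (q x))).continuousOn).continuousAt hnear).congr ?_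
    filter_upwards [hnear] with y hy
    exact (hΨN _ y hy).symm
  · intro x y z _ hxy
    rw [← hR x y z hxy]
    exact (hΨ _).map_eq x y z (mem_of_mem_nhds (hN _)) hxy

end Global

section Stabilizer

variable {n : ℕ} {X : Type*} [MulAction (Torus n) X]

/-- The character `χ` maps the stabilizer of `x` onto the circle. -/
def MapsStabilizerOnto (χ : Torus n → Circle) (x : X) : Prop :=
  ∀ z, ∃ t : Torus n, t • x = x ∧ χ t = z

theorem mapsStabilizerOnto_smul_iff {χ : Torus n → Circle} (g : Torus n) (x : X) :
    MapsStabilizerOnto χ (g • x) ↔ MapsStabilizerOnto χ x := by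
  have (t : Torus n) : t • g • x = g • x ↔ t • x = x := by
    rw [smul_comm, smul_left_cancel_iff]
  simp only [MapsStabilizerOnto, this]

end Stabilizer

section Charts

variable {n : ℕ} {X : Type*} [TopologicalSpace X]
  [ChartedSpace (EuclideanSpace ℝ (Fin (2 * n))) X] [MulAction (Torus n) X]

namespace StandardChart

variable (c : StandardChart n X)

theorem smul_eq_self_iff {x : X} (hx : x ∈ c.source) (t : Torus n) :
    t • x = x ↔ ∀ i, c.toFun x i ≠ 0 → c.aut t i = 1 := by
  constructor
  · intro h i hi
    have h1 := c.map_smul t x hx i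
    rw [h] at h1
    have h2 : (c.aut t i : ℂ) = 1 := by
      have := mul_right_cancel₀ hi ((one_mul _).trans h1)
      exact this.symm
    exact Circle.coe_eq_one.1 h2
  · intro h
    refine c.injOn (c.smul_mem_source t x hx) hx ?_
    ext i : 1
    refine (c.map_smul t x hx i).trans ?_
    by_cases hi : c.toFun x i = 0
    · rw [hi, mul_zero]; exact hi.symm
    · rw [h i hi, Circle.coe_one, one_mul]; rfl

theorem continuousOn_coord (i : Fin n) : ContinuousOn (fun x => c.toFun x i) c.source :=
  (continuous_apply i).comp_continuousOn c.continuousOn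

theorem eventually_ne_zero {y : X} (hy : y ∈ c.source) :
    ∀ᶠ z in nhds y, z ∈ c.source ∧ ∀ i, c.toFun y i ≠ 0 → c.toFun z i ≠ 0 := by
  refine Filter.Eventually.and (c.open_source.mem_nhds hy) (Filter.eventually_all.2 fun i => ?_)
  by_cases hi : c.toFun y i = 0
  · exact Filter.Eventually.of_forall fun z h => absurd hi h
  · exact (((c.continuousOn_coord i).continuousAt (c.open_source.mem_nhds hy)).eventually_ne hi).mono
      fun z h _ => h

theorem depth_eq_zero_iff {x : X} : c.depth x = 0 ↔ ∀ i, c.toFun x i ≠ 0 := by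
  rw [depth, Set.ncard_eq_zero (Set.toFinite _), Set.eq_empty_iff_forall_notMem]
  rfl

theorem eq_zero_of_depth_eq {x : X} (h : c.depth x = n) (i : Fin n) : c.toFun x i = 0 := by
  have : {i : Fin n | c.toFun x i = 0} = Set.univ :=
    Set.eq_of_subset_of_ncard_le (Set.subset_univ _) (by
      rw [Set.ncard_univ, Nat.card_eq_fintype_card, Fintype.card_fin]; exact h.ge) (Set.toFinite _)
  exact this.ge (Set.mem_univ i)

/-- Near a point, the points of the same depth have the same stabilizer. -/
theorem eventually_smul_eq_self_iff {y : X} (hy : y ∈ c.source) :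
    ∀ᶠ z in nhds y, c.depth z = c.depth y → ∀ t : Torus n, t • z = z ↔ t • y = y := by
  filter_upwards [c.eventually_ne_zero hy] with z hz hd t
  have hsub : {i : Fin n | c.toFun z i = 0} = {i : Fin n | c.toFun y i = 0} :=
    Set.eq_of_subset_of_ncard_le (fun i hi => by_contra fun h => hz.2 i h hi) hd.ge (Set.toFinite _)
  rw [c.smul_eq_self_iff hz.1, c.smul_eq_self_iff hy]
  exact forall_congr' fun i => imp_congr_left (not_congr (Set.ext_iff.1 hsub i))

/-- The weights of the tangent representation of a subgroup at a fixed point of the torus are the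
coordinates of a standard chart. -/
theorem areTangentWeights {x : X} (hx : x ∈ c.source) (hfix : ∀ t : Torus n, t • x = x)
    (T : Subgroup (Torus n)) (α : Fin n → (T →ₜ* Circle))
    (hα : ∀ i (t : T), α i t = c.aut t i) : AreTangentWeights x α := by
  have hdiff : c.toOpenPartialHomeomorph.MDifferentiable (𝓡 (2 * n)) 𝓘(ℝ, Fin n → ℂ) :=
    ⟨c.contMDiffOn_toFun.mdifferentiableOn (by simp), c.contMDiffOn_invFun.mdifferentiableOn (by simp)⟩
  have hL := (hdiff.mdifferentiableAt hx).hasMFDerivAt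
  have hLe : ∀ v, hdiff.mfderiv hx v =
    mfderiv (𝓡 (2 * n)) 𝓘(ℝ, Fin n → ℂ) c.toOpenPartialHomeomorph x v := fun _ => rfl
  refine ⟨(hdiff.mfderiv hx).toLinearEquiv, fun t v i => ?_⟩
  let D : (Fin n → ℂ) →L[ℝ] (Fin n → ℂ) :=
    ContinuousLinearMap.pi fun i => (c.aut t i : ℂ) • ContinuousLinearMap.proj (R := ℝ) i
  have hev : (fun y : X => c.toOpenPartialHomeomorph (t • y)) =ᶠ[nhds x]
      fun y => D (c.toOpenPartialHomeomorph y) := by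
    filter_upwards [c.open_source.mem_nhds hx] with y hy
    ext i
    exact c.map_smul t y hy i
  have hD : HasMFDerivAt (𝓡 (2 * n)) 𝓘(ℝ, Fin n → ℂ)
      (fun y => D (c.toOpenPartialHomeomorph y)) x
      (D.comp (mfderiv (𝓡 (2 * n)) 𝓘(ℝ, Fin n → ℂ) c.toOpenPartialHomeomorph x)) :=
    HasMFDerivAt.comp x (D.hasFDerivAt.hasMFDerivAt) hL
  have hDx : D (c.toOpenPartialHomeomorph x) = c.toOpenPartialHomeomorph x := by
    have := hev.self_of_nhds
    simp only at this
    rw [← this, show t • x = x from hfix t]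
  have hact : MDifferentiableAt (𝓡 (2 * n)) (𝓡 (2 * n)) (fun y : X => t • y) x := by
    have h1 : MDifferentiableAt 𝓘(ℝ, Fin n → ℂ) (𝓡 (2 * n)) c.toOpenPartialHomeomorph.symm
        (D (c.toOpenPartialHomeomorph x)) := by
      rw [hDx]
      exact hdiff.mdifferentiableAt_symm (c.map_source hx)
    have h2 := h1.comp x hD.mdifferentiableAt
    refine h2.congr_of_eventuallyEq ?_
    filter_upwards [hev, c.open_source.mem_nhds hx] with y hy hys
    simp only [Function.comp]
    rw [← hy]
    exact (c.left_inv (c.smul_mem_source t y hys)).symm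
  have hL' : HasMFDerivAt (𝓡 (2 * n)) 𝓘(ℝ, Fin n → ℂ) c.toOpenPartialHomeomorph (t • x)
      (mfderiv (𝓡 (2 * n)) 𝓘(ℝ, Fin n → ℂ) c.toOpenPartialHomeomorph x) := by
    have hfx : t • x = x := hfix t
    rw [hfx]
    exact hL
  have hcomp := (HasMFDerivAt.comp x hL' hact.hasMFDerivAt).congr_of_eventuallyEq hev.symm
  have huniq := hasMFDerivAt_unique hcomp hD
  have := congrFun (DFunLike.congr_fun huniq v) i
  rw [hα]
  exact this

end StandardChart

/-- In general position, a character with kernel `T` maps every coordinate circle at a fixed point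
onto the circle. -/
theorem StandardChart.mapsStabilizerOnto (c : StandardChart n X) {T : Subgroup (Torus n)}
    (hgen : IsInGeneralPosition n T X) {χ : Torus n →ₜ* Circle} (hχ : Function.Surjective χ)
    (hker : ∀ t ∈ T, χ t = 1) {x : X} (hx : x ∈ c.source) (hd : c.depth x = n)
    {z : X} (hz : z ∈ c.source) (hdz : c.depth z ≠ 0) : MapsStabilizerOnto χ z := by
  have hx0 := c.eq_zero_of_depth_eq hd
  have hfix (t : Torus n) : t • x = x :=
    (c.smul_eq_self_iff hx t).2 fun i hi => absurd (hx0 i) hi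
  let α : Fin n → (T →ₜ* Circle) := fun i =>
    ⟨((Pi.evalMonoidHom (fun _ => Circle) i).comp c.aut.toMulEquiv.toMonoidHom).comp T.subtype,
      ((continuous_apply i).comp c.aut.continuous_toFun).comp continuous_subtype_val⟩
  have hα (i) (t : T) : α i t = c.aut t i := rfl
  have hind := hgen x (fun t => hfix t) α (c.areTangentWeights hx hfix T α hα)
  obtain ⟨m, hm⟩ := exists_eq_torusMonomial
    (⟨χ.toMonoidHom.comp c.aut.symm.toMulEquiv.toMonoidHom,
      χ.continuous_toFun.comp c.aut.symm.continuous_toFun⟩ : Torus n →ₜ* Circle)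
  have hm' (s : Torus n) : χ (c.aut.symm s) = torusMonomial m s := DFunLike.congr_fun hm s
  have hmi (i : Fin n) : m i ≠ 0 := by
    intro hi
    have hsum : ∑ j : {j // j ≠ i}, m j • Additive.ofMul (α j) = 0 := by
      apply Additive.toMul.injective
      ext t : 1
      rw [toMul_sum, toMul_zero]
      simp only [toMul_zsmul, toMul_ofMul]
      have h1 : torusMonomial m (c.aut t) = 1 := by
        rw [← hm', ContinuousMulEquiv.symm_apply_apply]
        exact hker t t.2
      rw [torusMonomial_apply, Fintype.prod_eq_mul_prod_subtype_ne _ i, hi, zpow_zero, one_mul] at h1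
      let ev : (T →ₜ* Circle) →* Circle :=
        { toFun := fun f => f t, map_one' := rfl, map_mul' := fun _ _ => rfl }
      change ev (∏ j : {j // j ≠ i}, α j ^ m j) = 1
      rw [map_prod, ← h1]
      exact Finset.prod_congr rfl fun j _ => map_zpow ev _ _
    have hzero := Fintype.linearIndependent_iff.1 (hind i) (fun j => m j) hsum
    have hm0 : m = 0 := by
      ext j
      by_cases hj : j = i
      · rw [hj, hi]; rfl
      · exact hzero ⟨j, hj⟩
    obtain ⟨t, ht⟩ := hχ (-1)
    have := hm' (c.aut t)
    rw [ContinuousMulEquiv.symm_apply_apply, ht, hm0, torusMonomial_zero] at this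
    have h2 := congrArg (Subtype.val) this
    norm_num at h2
  obtain ⟨i, hi⟩ : ∃ i, c.toFun z i = 0 := by
    by_contra! h
    exact hdz (c.depth_eq_zero_iff.2 h)
  intro w
  obtain ⟨u, hu⟩ := circle_zpow_surjective (hmi i) w
  refine ⟨c.aut.symm (Pi.mulSingle i u), (c.smul_eq_self_iff hz _).2 fun j hj => ?_, ?_⟩
  · have : j ≠ i := fun h => hj (h ▸ hi)
    simp [this]
  · rw [hm', torusMonomial_mulSingle, hu]

end Charts

section OrbitSpace

variable {n : ℕ} {X : Type*} [TopologicalSpace X] [MulAction (Torus n) X]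
  [ContinuousSMul (Torus n) X] {K : Type*} [TopologicalSpace K]

/-- A space is compact if its orbit space under a compact group is. -/
theorem compactSpace_of_orbitSpace [CompactSpace K]
    (h : Quotient (MulAction.orbitRel (Torus n) X) ≃ₜ K) : CompactSpace X := by
  have hc : CompactSpace (Quotient (MulAction.orbitRel (Torus n) X)) := h.symm.compactSpace
  let π : X → Quotient (MulAction.orbitRel (Torus n) X) := Quotient.mk _
  have hclosed : IsClosedMap π := by
    intro C hC
    rw [← (show Topology.IsQuotientMap π from isQuotientMap_quot_mk).isClosed_preimage]
    have : π ⁻¹' (π '' C) =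
        Prod.snd '' {p : Torus n × X | p.1 • p.2 ∈ C} := by
      ext x
      constructor
      · rintro ⟨y, hy, hyx⟩
        obtain ⟨g, rfl⟩ := MulAction.orbitRel_apply.1 (Quotient.exact hyx)
        exact ⟨(g, x), hy, rfl⟩
      · rintro ⟨⟨g, y⟩, hy, rfl⟩
        exact ⟨g • y, hy, Quotient.sound (MulAction.orbitRel_apply.2 ⟨g, rfl⟩)⟩
    rw [this]
    exact isClosedMap_snd_of_compactSpace _ (hC.preimage continuous_smul)
  have hproper : IsProperMap π := by
    refine isProperMap_iff_isClosedMap_and_compact_fibers.2 ⟨continuous_quot_mk, hclosed, fun y => ?_⟩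
    induction y using Quotient.inductionOn with
    | h x =>
      have : π ⁻¹' {Quotient.mk _ x} = Set.range fun g : Torus n => g • x := by
        ext y
        exact Quotient.eq.trans MulAction.orbitRel_apply
      rw [this]
      exact isCompact_range (by fun_prop)
  exact ⟨by simpa using hproper.isCompact_preimage isCompact_univ⟩

end OrbitSpace

section Quasitoric

variable {n : ℕ} {X : Type*} [TopologicalSpace X]
  [ChartedSpace (EuclideanSpace ℝ (Fin (2 * n))) X] [MulAction (Torus n) X]
  [ContinuousSMul (Torus n) X] {P : SimplePolytope n}

/-- Over boundary points of the polytope the character `χ` maps stabilizers onto the circle. -/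
theorem mapsStabilizerOnto_of_depth_ne_zero (hX : IsLocallyStandard n X)
    (h : Quotient (MulAction.orbitRel (Torus n) X) ≃ₜ P.carrier)
    (hd : ∀ (c : StandardChart n X) (x : X), x ∈ c.source →
        P.depth (h (Quotient.mk _ x)) = c.depth x)
    {T : Subgroup (Torus n)} (hgen : IsInGeneralPosition n T X) {χ : Torus n →ₜ* Circle}
    (hχ : Function.Surjective χ) (hker : ∀ t ∈ T, χ t = 1) (x : X)
    (hx : P.depth (h (Quotient.mk _ x)) ≠ 0) : MapsStabilizerOnto χ x := by
  let π : X → P.carrier := fun x => h (Quotient.mk _ x)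
  have hπo : IsOpenMap π := h.isOpenMap.comp isOpenMap_quotient_mk'_mul
  have hπs : Function.Surjective π := h.surjective.comp Quotient.mk_surjective
  have hπ (y z : X) (hyz : π y = π z) : MapsStabilizerOnto χ y ↔ MapsStabilizerOnto χ z := by
    obtain ⟨g, rfl⟩ := MulAction.orbitRel_apply.1 (Quotient.exact (h.injective hyz))
    exact mapsStabilizerOnto_smul_iff g z
  obtain ⟨γ, hγc, hγ0, hγ1, hγP, hγd⟩ := P.exists_segment (π x).2
  let δ : Set.Icc (0 : ℝ) 1 → P.carrier := fun t => ⟨γ t, hγP t t.2⟩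
  have hδ : Continuous δ := by fun_prop
  choose s hs using hπs
  have hnear (t₀ : Set.Icc (0 : ℝ) 1) {p : X → Prop} (hp : ∀ᶠ z in nhds (s (δ t₀)), p z) :
      ∀ᶠ t in nhds t₀, ∃ z, p z ∧ π z = δ t := by
    have h1 : π '' {z | p z} ∈ nhds (δ t₀) := by
      have := hπo.image_mem_nhds hp
      rwa [hs] at this
    exact hδ.continuousAt h1
  have hzero : π x = δ ⟨0, by simp⟩ := Subtype.ext hγ0.symm
  rw [hπ x (s (δ ⟨0, by simp⟩)) (hzero.trans (hs _).symm)]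
  have hdep (t : Set.Icc (0 : ℝ) 1) (ht : t.1 < 1) : P.depth (δ t) = P.depth (π x) :=
    hγd t ⟨t.2.1, ht⟩
  -- near the vertex
  obtain ⟨t₁, ht₁, hgood⟩ : ∃ t : Set.Icc (0 : ℝ) 1, t.1 < 1 ∧ MapsStabilizerOnto χ (s (δ t)) := by
    obtain ⟨c, hc⟩ := hX (s (δ ⟨1, by simp⟩))
    have hdc : c.depth (s (δ ⟨1, by simp⟩)) = n := by
      rw [← hd c _ hc]
      change P.depth (π _) = n
      rw [hs]
      exact hγ1
    have hev := hnear ⟨1, by simp⟩ (c.open_source.mem_nhds hc)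
    obtain ⟨ε, hε, hball⟩ := Metric.eventually_nhds_iff.1 hev
    let t : Set.Icc (0 : ℝ) 1 := ⟨1 - min (ε / 2) 1, by
      constructor
      · linarith [min_le_right (ε / 2) 1]
      · have : 0 < min (ε / 2) 1 := lt_min (by linarith) one_pos
        linarith⟩
    have hm : 0 < min (ε / 2) 1 := lt_min (by linarith) one_pos
    have ht : t.1 < 1 := by simp only [t]; linarith
    obtain ⟨z, hz, hzt⟩ := hball (y := t) (by
      rw [Subtype.dist_eq, Real.dist_eq]
      simp only [t, sub_sub_cancel_left, abs_neg, abs_of_pos hm]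
      linarith [min_le_left (ε / 2) 1])
    refine ⟨t, ht, (hπ z _ (hzt.trans (hs _).symm)).1 ?_⟩
    refine c.mapsStabilizerOnto hgen hχ hker hc hdc hz ?_
    rw [← hd c z hz]
    change P.depth (π z) ≠ 0
    rw [hzt, hdep t ht]
    exact hx
  -- along the segment
  let f : Set.Ico (0 : ℝ) 1 → Prop := fun t =>
    MapsStabilizerOnto χ (s (δ ⟨t, t.2.1, t.2.2.le⟩))
  have hf : IsLocallyConstant f := by
    rw [IsLocallyConstant.iff_eventually_eq]
    intro t₀
    obtain ⟨c, hc⟩ := hX (s (δ ⟨t₀, t₀.2.1, t₀.2.2.le⟩))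
    have hev := hnear ⟨t₀, t₀.2.1, t₀.2.2.le⟩
      ((c.open_source.eventually_mem hc).and (c.eventually_smul_eq_self_iff hc))
    have hincl : Continuous fun t : Set.Ico (0 : ℝ) 1 =>
      (⟨t, t.2.1, t.2.2.le⟩ : Set.Icc (0 : ℝ) 1) := by fun_prop
    filter_upwards [hincl.continuousAt.eventually hev] with t ⟨z, ⟨hz, hstab⟩, hzt⟩
    have hdz : c.depth z = c.depth (s (δ ⟨t₀, t₀.2.1, t₀.2.2.le⟩)) := by
      rw [← hd c _ hc, ← hd c z hz]
      change P.depth (π _) = P.depth (π _)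
      rw [hzt, hs, hdep _ t.2.2, hdep _ t₀.2.2]
    have hstab := hstab hdz
    refine propext ((hπ _ z ((hs _).trans hzt.symm)).trans ?_)
    simp only [MapsStabilizerOnto, hstab]
    exact Iff.rfl
  have : PreconnectedSpace (Set.Ico (0 : ℝ) 1) := Subtype.preconnectedSpace isPreconnected_Ico
  have := hf.apply_eq_of_preconnectedSpace ⟨0, by simp⟩ ⟨t₁, t₁.2.1, ht₁⟩
  exact this.mpr hgood

end Quasitoric

/-- The phase `z / |z|` of a complex number, with the value `1` at `0`. -/
noncomputable def circlePhase (z : ℂ) : Circle := Circle.exp z.arg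

theorem isInducing_circle_coe : Topology.IsInducing (fun z : Circle => (z : ℂ)) := ⟨rfl⟩

theorem coe_circlePhase {z : ℂ} (hz : z ≠ 0) : (circlePhase z : ℂ) = z / ‖z‖ := by
  rw [circlePhase, Circle.coe_exp, eq_div_iff (by exact_mod_cast norm_ne_zero_iff.2 hz), mul_comm,
    Complex.norm_mul_exp_arg_mul_I]

theorem circlePhase_mul (w : Circle) {z : ℂ} (hz : z ≠ 0) :
    circlePhase (w * z) = w * circlePhase z := by
  ext
  rw [Circle.coe_mul, coe_circlePhase hz, coe_circlePhase (mul_ne_zero w.coe_ne_zero hz), norm_mul,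
    Circle.norm_coe, one_mul, mul_div_assoc]

theorem continuousOn_circlePhase : ContinuousOn circlePhase {0}ᶜ := by
  rw [isInducing_circle_coe.continuousOn_iff]
  refine ContinuousOn.congr (f := fun z : ℂ => z / ‖z‖) ?_ fun z hz => coe_circlePhase hz
  exact continuousOn_id.div (by fun_prop) fun z hz => by simpa using hz

section Equivariant

variable {n : ℕ} {X : Type*} [TopologicalSpace X]
  [ChartedSpace (EuclideanSpace ℝ (Fin (2 * n))) X] [MulAction (Torus n) X]
  [ContinuousSMul (Torus n) X] {P : SimplePolytope n}

theorem SimplePolytope.exists_homeomorph_interior (P : SimplePolytope n) :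
    Nonempty ({p : P.carrier | P.depth p = 0} ≃ₜ (Fin n → ℝ)) := by
  obtain ⟨Φ, hΦ, -, -⟩ := exists_homeomorph_image_interior_closure_frontier_eq_unitBall
    P.convex_carrier P.nonempty_interior P.isBounded
  let j : {p : P.carrier | P.depth p = 0} ≃ₜ interior P.carrier :=
    { toFun := fun p => ⟨p.1.1, (P.mem_interior_iff p.1.2).2 p.2⟩
      invFun := fun p => ⟨⟨p.1, interior_subset p.2⟩, (P.mem_interior_iff (interior_subset p.2)).1 p.2⟩
      left_inv := fun _ => rfl
      right_inv := fun _ => rfl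
      continuous_toFun := by fun_prop
      continuous_invFun := by fun_prop }
  exact ⟨(((j.trans (Φ.image _)).trans (Homeomorph.setCongr hΦ)).trans
    Homeomorph.unitBall.symm).trans (EuclideanSpace.equiv (Fin n) ℝ).toHomeomorph⟩

/-- Over the interior of the polytope there is a map to the circle which is equivariant with respect
to a given character. -/
theorem exists_equivariant_map (hX : IsLocallyStandard n X)
    (h : Quotient (MulAction.orbitRel (Torus n) X) ≃ₜ P.carrier)
    (hd : ∀ (c : StandardChart n X) (x : X), x ∈ c.source →
        P.depth (h (Quotient.mk _ x)) = c.depth x)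
    (χ : Torus n →ₜ* Circle) :
    ∃ ψ : X → Circle, ContinuousOn ψ {x | P.depth (h (Quotient.mk _ x)) = 0} ∧
      ∀ (g : Torus n) (x : X), P.depth (h (Quotient.mk _ x)) = 0 → ψ (g • x) = χ g * ψ x := by
  let π : X → P.carrier := fun x => h (Quotient.mk _ x)
  have hπo : IsOpenMap π := h.isOpenMap.comp isOpenMap_quotient_mk'_mul
  have hπc : Continuous π := h.continuous.comp continuous_quot_mk
  have hπs : Function.Surjective π := h.surjective.comp Quotient.mk_surjective
  have hπg (g : Torus n) (x : X) : π (g • x) = π x :=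
    congrArg h (Quotient.sound (MulAction.orbitRel_apply.2 ⟨g, rfl⟩))
  obtain ⟨e⟩ := P.exists_homeomorph_interior
  let S : Set P.carrier := {p : P.carrier | P.depth p = 0}
  let q : π ⁻¹' S → (Fin n → ℝ) := fun x => e (S.restrictPreimage π x)
  have hq : IsOpenQuotientMap q :=
    ⟨e.surjective.comp (Set.restrictPreimage_surjective S hπs),
      e.continuous.comp hπc.restrictPreimage, e.isOpenMap.comp (hπo.restrictPreimage S)⟩
  let R : π ⁻¹' S → π ⁻¹' S → Circle → Prop := fun x y z => ∃ g : Torus n, y.1 = g • x.1 ∧ z = χ g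
  have hqR (x y : π ⁻¹' S) : q x = q y ↔ ∃ g : Torus n, y.1 = g • x.1 := by
    constructor
    · intro hxy
      have h1 : π y.1 = π x.1 := (congrArg Subtype.val (e.injective hxy)).symm
      obtain ⟨g, hg⟩ := MulAction.orbitRel_apply.1 (Quotient.exact (h.injective h1))
      exact ⟨g, hg.symm⟩
    · rintro ⟨g, hg⟩
      refine congrArg e (Subtype.ext ?_)
      change π x.1 = π y.1
      rw [hg, hπg]
  have hR (x y z) (hxy : R x y z) : q x = q y := by
    obtain ⟨g, hg, -⟩ := hxy
    exact (hqR x y).2 ⟨g, hg⟩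
  have hR' (x y) (hxy : q x = q y) : ∃ z, R x y z := by
    obtain ⟨g, hg⟩ := (hqR x y).1 hxy
    exact ⟨χ g, g, hg, rfl⟩
  have hloc (b : Fin n → ℝ) : ∃ V ∈ nhds b, ∃ ψ, IsEquivariantOver q R V ψ := by
    obtain ⟨x, rfl⟩ := hq.surjective b
    obtain ⟨c, hc⟩ := hX x
    let U : Set (π ⁻¹' S) := {y | y.1 ∈ c.source}
    have hU : IsOpen U := c.open_source.preimage continuous_subtype_val
    have hpre : q ⁻¹' (q '' U) = U := by
      refine Set.Subset.antisymm ?_ (Set.subset_preimage_image q U)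
      rintro y ⟨z, hz, hzy⟩
      obtain ⟨g, hg⟩ := (hqR z y).1 hzy
      change y.1 ∈ c.source
      rw [hg]
      exact c.smul_mem_source g _ hz
    have hne (y : π ⁻¹' S) (hy : y ∈ U) (i : Fin n) : c.toFun y.1 i ≠ 0 :=
      c.depth_eq_zero_iff.1 ((hd c y.1 hy).symm.trans y.2) i
    refine ⟨q '' U, (hq.isOpenMap _ hU).mem_nhds ⟨x, hc, rfl⟩,
      fun y => χ (c.aut.symm fun i => circlePhase (c.toFun y.1 i)), ?_, ?_⟩
    · rw [hpre]
      refine (χ.continuous_toFun.comp c.aut.symm.continuous_toFun).comp_continuousOn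
        (continuousOn_pi.2 fun i => ?_)
      refine ContinuousOn.comp (g := circlePhase) (t := {0}ᶜ) continuousOn_circlePhase
        ((c.continuousOn_coord i).comp continuous_subtype_val.continuousOn fun y hy => hy) ?_
      exact fun y hy => hne y hy i
    · rintro y z w hy ⟨g, hg, rfl⟩
      have hyU : y ∈ U := hpre ▸ hy
      simp only [hg]
      rw [← map_mul]
      congr 1
      apply c.aut.injective
      rw [map_mul, ContinuousMulEquiv.apply_symm_apply, ContinuousMulEquiv.apply_symm_apply]
      ext1 i
      rw [c.map_smul g y.1 hyU i, circlePhase_mul _ (hne y hyU i)]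
      rfl
  obtain ⟨ψ, hψ⟩ := IsEquivariantOver.exists_global hq hR hR' hloc
  classical
  have hval (x : X) (hx : x ∈ π ⁻¹' S) :
      (if hx : x ∈ π ⁻¹' S then ψ ⟨x, hx⟩ else 1) = ψ ⟨x, hx⟩ := dif_pos hx
  refine ⟨fun x => if hx : x ∈ π ⁻¹' S then ψ ⟨x, hx⟩ else 1, ?_, ?_⟩
  · change ContinuousOn _ (π ⁻¹' S)
    rw [continuousOn_iff_continuous_domRestrict]
    have : (π ⁻¹' S).domRestrict (fun x => if hx : x ∈ π ⁻¹' S then ψ ⟨x, hx⟩ else 1) = ψ := by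
      ext1 x
      exact hval x.1 x.2
    rw [this, ← continuousOn_univ]
    exact hψ.continuousOn
  · intro g x hx
    have hx' : x ∈ π ⁻¹' S := hx
    have hgx : g • x ∈ π ⁻¹' S := by rw [Set.mem_preimage, hπg]; exact hx
    simp only [hval x hx', hval (g • x) hgx]
    exact hψ.map_eq ⟨x, hx'⟩ ⟨g • x, hgx⟩ (χ g) (Set.mem_univ _) ⟨g, rfl, rfl⟩

end Equivariant

theorem exists_homeomorph_prod_complex (n : ℕ) :
    ∃ J : EuclideanSpace ℝ (Fin n) × ℂ ≃ₜ EuclideanSpace ℝ (Fin (n + 2)),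
      ∀ p, ‖J p‖ ^ 2 = ‖p.1‖ ^ 2 + ‖p.2‖ ^ 2 := by
  let J : EuclideanSpace ℝ (Fin n) × ℂ ≃ₜ EuclideanSpace ℝ (Fin (n + 2)) :=
    { toFun := fun p => WithLp.toLp 2 (Fin.append p.1 ![p.2.re, p.2.im])
      invFun := fun v => (WithLp.toLp 2 fun i => v (Fin.castAdd 2 i),
        ⟨v (Fin.natAdd n 0), v (Fin.natAdd n 1)⟩)
      left_inv := fun p => by
        ext <;> simp
      right_inv := fun v => by
        ext i
        induction i using Fin.addCases with
        | left i => simp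
        | right i => fin_cases i <;> simp
      continuous_toFun := by
        refine (PiLp.continuous_toLp 2 _).comp (continuous_pi fun i => ?_)
        induction i using Fin.addCases with
        | left i => simp only [Fin.append_left]; fun_prop
        | right i => fin_cases i <;> simp <;> fun_prop
      continuous_invFun := by
        refine Continuous.prodMk (by fun_prop) ?_
        have : (fun v : EuclideanSpace ℝ (Fin (n + 2)) =>
            (⟨v (Fin.natAdd n 0), v (Fin.natAdd n 1)⟩ : ℂ)) = fun v =>
            Complex.equivRealProdCLM.symm (v (Fin.natAdd n 0), v (Fin.natAdd n 1)) := rfl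
        rw [this]
        fun_prop }
  refine ⟨J, fun p => ?_⟩
  rw [EuclideanSpace.norm_sq_eq, EuclideanSpace.norm_sq_eq, Fin.sum_univ_add, Complex.sq_norm,
    Complex.normSq_apply]
  simp [J, ← pow_two]

theorem theorem2 (n : ℕ) (hn : 1 ≤ n)
    (X : Type*) [TopologicalSpace X] [T2Space X] [SecondCountableTopology X]
    [ChartedSpace (EuclideanSpace ℝ (Fin (2 * n))) X] [IsManifold (𝓡 (2 * n)) ∞ X]
    [MulAction (Torus n) X] [ContinuousSMul (Torus n) X]
    (hX : IsQuasitoric n X)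
    (T : Subgroup (Torus n)) (hT : IsSubtorus (n - 1) T)
    (hgen : IsInGeneralPosition n T X) :
    Nonempty (Quotient (MulAction.orbitRel T X) ≃ₜ
      Metric.sphere (0 : EuclideanSpace ℝ (Fin (n + 2))) 1) := by
  obtain ⟨hls, P, h, hd⟩ := hX
  obtain ⟨m, hm0, hker⟩ := hT.exists_torusMonomial hn
  set χ := torusMonomial m
  have hχ : Function.Surjective χ := torusMonomial_surjective hm0
  obtain ⟨ψ, hψc, hψ⟩ := exists_equivariant_map hls h hd χ
  have hstab := mapsStabilizerOnto_of_depth_ne_zero hls h hd hgen hχ fun t ht => (hker t).2 ht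
  have : CompactSpace P.carrier := isCompact_iff_compactSpace.1 P.isCompact_carrier
  have hcomp : CompactSpace X := compactSpace_of_orbitSpace h
  obtain ⟨Φ, hΦi, hΦc, -⟩ := exists_homeomorph_image_interior_closure_frontier_eq_unitBall
    P.convex_carrier P.nonempty_interior P.isBounded
  obtain ⟨J, hJ⟩ := exists_homeomorph_prod_complex n
  let u : X → EuclideanSpace ℝ (Fin n) := fun x => Φ (h (Quotient.mk _ x))
  have huc : Continuous u :=
    Φ.continuous.comp (continuous_subtype_val.comp (h.continuous.comp continuous_quot_mk))
  have hug (g : Torus n) (x : X) : u (g • x) = u x :=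
    congrArg (fun y => Φ (h y)) (Quotient.sound (MulAction.orbitRel_apply.2 ⟨g, rfl⟩))
  have hu_eq (x y : X) (hxy : u x = u y) : ∃ g : Torus n, g • y = x :=
    MulAction.orbitRel_apply.1
      (Quotient.exact (h.injective (Subtype.ext (Φ.injective hxy))))
  have hu_le (x : X) : ‖u x‖ ≤ 1 := by
    rw [← mem_closedBall_zero_iff, ← hΦc]
    exact Set.mem_image_of_mem _ (subset_closure (h (Quotient.mk _ x)).2)
  have hu_lt (x : X) : ‖u x‖ < 1 ↔ P.depth (h (Quotient.mk _ x)) = 0 := by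
    rw [← mem_ball_zero_iff, ← hΦi, ← P.mem_interior_iff (h (Quotient.mk _ x)).2]
    exact Φ.injective.mem_set_image
  have hu_surj (a : EuclideanSpace ℝ (Fin n)) (ha : ‖a‖ ≤ 1) : ∃ x, u x = a := by
    rw [← mem_closedBall_zero_iff, ← hΦc, P.isClosed_carrier.closure_eq] at ha
    obtain ⟨p, hp, rfl⟩ := ha
    obtain ⟨y, hy⟩ := h.surjective ⟨p, hp⟩
    obtain ⟨x, rfl⟩ := Quotient.mk_surjective y
    exact ⟨x, by simp only [u, hy]⟩
  let ρ : X → ℝ := fun x => Real.sqrt (1 - ‖u x‖ ^ 2)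
  have hρc : Continuous ρ := by fun_prop
  have hρ_sq (x : X) : ρ x ^ 2 = 1 - ‖u x‖ ^ 2 :=
    Real.sq_sqrt (by nlinarith [hu_le x, norm_nonneg (u x)])
  have hρ_pos (x : X) : 0 < ρ x ↔ P.depth (h (Quotient.mk _ x)) = 0 := by
    rw [← hu_lt, Real.sqrt_pos, sub_pos, sq_lt_one_iff₀ (norm_nonneg _)]
  have hρ_zero (x : X) (hx : P.depth (h (Quotient.mk _ x)) ≠ 0) : ρ x = 0 :=
    le_antisymm (not_lt.1 fun hlt => hx ((hρ_pos x).1 hlt)) (Real.sqrt_nonneg _)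
  have hρg (g : Torus n) (x : X) : ρ (g • x) = ρ x := by simp only [ρ, hug]
  let w : X → ℂ := fun x => ρ x * ψ x
  have hw_norm (x : X) : ‖w x‖ = ρ x := by
    rw [norm_mul, Circle.norm_coe, mul_one, Complex.norm_real, Real.norm_eq_abs,
      abs_of_nonneg (show 0 ≤ ρ x from Real.sqrt_nonneg _)]
  have hwc : Continuous w := by
    rw [continuous_iff_continuousAt]
    intro x
    by_cases hx : P.depth (h (Quotient.mk _ x)) = 0
    · have hopen : IsOpen {x | P.depth (h (Quotient.mk _ x)) = 0} := by
        simp only [← hu_lt]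
        exact isOpen_lt (by fun_prop) continuous_const
      have hψx : ContinuousAt ψ x := hψc.continuousAt (hopen.mem_nhds hx)
      exact (Complex.continuous_ofReal.comp hρc).continuousAt.mul
        (isInducing_circle_coe.continuous.continuousAt.comp hψx)
    · have hx0 : w x = 0 := by simp [w, hρ_zero x hx]
      rw [ContinuousAt, hx0]
      refine squeeze_zero_norm (fun y => (hw_norm y).le) ?_
      rw [← hρ_zero x hx]
      exact hρc.continuousAt
  let F : X → Metric.sphere (0 : EuclideanSpace ℝ (Fin (n + 2))) 1 := fun x =>
    ⟨J (u x, w x), by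
      rw [mem_sphere_zero_iff_norm, ← sq_eq_sq₀ (norm_nonneg _) zero_le_one, hJ]
      simp only [hw_norm, hρ_sq]
      ring⟩
  have hFc : Continuous F := (J.continuous.comp (huc.prodMk hwc)).subtype_mk _
  have hF_eq (x y : X) : F x = F y ↔ u x = u y ∧ w x = w y := by
    rw [Subtype.ext_iff]
    exact J.injective.eq_iff.trans Prod.mk_inj
  have hFT (x y : X) : F x = F y ↔ ∃ t : T, t • y = x := by
    rw [hF_eq]
    constructor
    · rintro ⟨h1, h2⟩
      obtain ⟨g, rfl⟩ := hu_eq x y h1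
      by_cases hy : P.depth (h (Quotient.mk _ y)) = 0
      · have hpos : (ρ y : ℂ) ≠ 0 := by exact_mod_cast ((hρ_pos y).2 hy).ne'
        simp only [w, hρg, hψ g y hy] at h2
        have h3 := Circle.coe_injective (mul_left_cancel₀ hpos h2)
        exact ⟨⟨g, (hker g).1 (mul_eq_right.1 h3)⟩, rfl⟩
      · obtain ⟨k, hk, hkg⟩ := hstab y hy (χ g)
        refine ⟨⟨g * k⁻¹, (hker _).1 (by rw [map_mul, map_inv, hkg, mul_inv_cancel])⟩, ?_⟩
        change (g * k⁻¹) • y = g • y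
        rw [mul_smul, inv_smul_eq_iff.2 hk.symm]
    · rintro ⟨t, rfl⟩
      change u ((t : Torus n) • y) = u y ∧ w ((t : Torus n) • y) = w y
      refine ⟨hug _ _, ?_⟩
      by_cases hy : P.depth (h (Quotient.mk _ y)) = 0
      · simp only [w, hρg, hψ _ y hy, (hker t).2 t.2, one_mul]
      · simp [w, hρg, hρ_zero y hy]
  have hFs : Function.Surjective F := by
    rintro ⟨v, hv⟩
    obtain ⟨⟨a, z⟩, rfl⟩ := J.surjective v
    have hsum : ‖a‖ ^ 2 + ‖z‖ ^ 2 = 1 := by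
      have := hJ (a, z)
      rw [mem_sphere_zero_iff_norm.1 hv] at this
      linarith
    have ha : ‖a‖ ≤ 1 := by nlinarith [norm_nonneg a, sq_nonneg ‖z‖]
    obtain ⟨x, rfl⟩ := hu_surj a ha
    have hρz : ρ x = ‖z‖ := by
      rw [← sq_eq_sq₀ (Real.sqrt_nonneg _) (norm_nonneg _), hρ_sq]
      linarith
    by_cases hz : z = 0
    · refine ⟨x, Subtype.ext (congrArg J (Prod.ext rfl ?_))⟩
      rw [hz, norm_zero] at hρz
      simp [w, hρz, hz]
    · obtain ⟨g, hg⟩ := hχ (circlePhase z / ψ x)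
      have hx : P.depth (h (Quotient.mk _ x)) = 0 := by
        rw [← hρ_pos, hρz]
        exact norm_pos_iff.2 hz
      refine ⟨g • x, Subtype.ext (congrArg J (Prod.ext (hug g x) ?_))⟩
      simp only [w, hρg, hψ g x hx, hg, div_mul_cancel, hρz, coe_circlePhase hz]
      exact mul_div_cancel₀ _ (by exact_mod_cast norm_ne_zero_iff.2 hz)
  let F' : Quotient (MulAction.orbitRel T X) → Metric.sphere (0 : EuclideanSpace ℝ (Fin (n + 2))) 1 :=
    Quotient.lift F fun x y hxy => (hFT x y).2 (MulAction.orbitRel_apply.1 hxy)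
  have hF'c : Continuous F' := hFc.quotient_lift _
  have hF'b : Function.Bijective F' := by
    constructor
    · intro a b
      induction a using Quotient.inductionOn with | h x =>
      induction b using Quotient.inductionOn with | h y =>
      intro hxy
      exact Quotient.sound (MulAction.orbitRel_apply.2 ((hFT x y).1 hxy))
    · intro v
      obtain ⟨x, hx⟩ := hFs v
      exact ⟨Quotient.mk _ x, hx⟩
  exact ⟨Continuous.homeoOfEquivCompactToT2 (f := Equiv.ofBijective F' hF'b) hF'c⟩
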